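/- Let $n\ge 0$ and let $M$ be a closed (compact, without boundary) connected Hausdorff affine $(n+1)$-manifold, i.e. its charts take values in $\mathbb{R}^{n+1}$ and the transition maps agree with affine automorphisms on each connected component of their domains. Let $p:\widetilde M\to M$ be its universal cover with the lifted affine structure, let $\Gamma=\pi_1(M)$ act on $\widetilde M$ by deck transformations, and let $(\mathrm{dev},\mathrm{hol})$ be a developing pair: $\mathrm{dev}:\widetilde M\to\mathbb{R}^{n+1}$ is a local affine isomorphism, $\mathrm{hol}:\Gamma\to\mathrm{Aff}(n+1,\mathbb{R})$ is a homomorphism, and $\mathrm{dev}\circ\gamma=\mathrm{hol}(\gamma)\circ\mathrm{dev}$ for all $\gamma\in\Gamma$. Suppose that the affine holonomy group $\mathrm{hol}(\Gamma)$ preserves a nonzero parallel (constant) vector field $v$ on $\mathbb{R}^{n+1}$, i.e. the linear part of every element of $\mathrm{hol}(\Gamma)$ fixes $v$. Then there is a complete parallel flow $(\widetilde\Theta_t)_{t\in\mathbb{R}}$ on $\widetilde M$, i.e. a smooth $\mathbb{R}$-action generated by a nowhere vanishing vector field that is locally constant in affine charts, such that $$\mathrm{dev}(\widetilde\Theta_t(x))=\mathrm{dev}(x)+t\,v\qquad(t\in\mathbb{R},\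 x\in\widetilde M),$$ and every point of $\widetilde M$ lies in an open set $W\subseteq\widetilde M$ that is invariant under the flow and on which $\mathrm{dev}$ restricts to a diffeomorphism onto its (open) image. Moreover, such sets arise as saturations of transverse chart domains: for every choice of affine coordinates $A:\mathbb{R}^{n+1}\to\mathbb{R}\times\mathbb{R}^n$ whose linear part maps $v$ to $(1,0)$, there are a smooth $n$-manifold $N$, a diffeomorphism $\Phi:\widetilde M\to\mathbb{R}\times N$ that carries $\widetilde\Theta_t$ to the translation $(s,y)\mapsto(s+t,y)$, and a local diffeomorphism $\overline{\mathrm{dev}}:N\to\mathbb{R}^n$ such that, with $p_2$ denoting projection to the second factor, $p_2\circ A\circ\mathrm{dev}=\overline{\mathrm{dev}}\circ p_2\circ\Phi$; and for every open $U\subseteq N$ on which $\overline{\mathrm{dev}}$ is a diffeomorphism onto its (open) image, $\mathrm{dev}$ restricts to a diffeomorphism from $\Phi^{-1}(\mathbb{R}\times U)$ onto its (open) image. -/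

import Mathlib

open Set Filter Topology Manifold
open scoped ContDiff

universe u w

/-- Affine `d`-space, with an origin chosen. -/
abbrev AffSpace (d : ℕ) : Type := EuclideanSpace ℝ (Fin d)

/-- The affine group `Aff(d, ℝ)`, under composition. -/
abbrev AffGroup (d : ℕ) : Type := AffSpace d ≃ᵃ[ℝ] AffSpace d

/-- The pregroupoid of maps that coincide near each point with some affine automorphism. -/
def affinePregroupoid (d : ℕ) : Pregroupoid (AffSpace d) where
  property f u := ∀ x ∈ u, ∃ g : AffGroup d, ∀ᶠ y in 𝓝 x, f y = g y
  comp := by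
    intro f g u v hf hg _ _ huv x hx
    obtain ⟨a, ha⟩ := hf x hx.1
    obtain ⟨b, hb⟩ := hg (f x) hx.2
    refine ⟨a.trans b, ?_⟩
    have hcont : Tendsto f (𝓝 x) (𝓝 (f x)) := by
      have h1 : ContinuousAt (fun y => a y) x :=
        (AffineMap.continuous_of_finiteDimensional a.toAffineMap).continuousAt
      exact (h1.congr (ha.mono fun y hy => hy.symm))
    filter_upwards [ha, hcont.eventually hb] with y h1 h2
    rw [Function.comp_apply, h2, h1, AffineEquiv.trans_apply]
  id_mem := fun x _ => ⟨1, Eventually.of_forall fun y => rfl⟩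
  locality := by
    intro f u _ h x hx
    obtain ⟨v, _, hxv, hv⟩ := h x hx
    exact hv x ⟨hx, hxv⟩
  congr := by
    intro f g u hu hfg hf x hx
    obtain ⟨a, ha⟩ := hf x hx
    refine ⟨a, ?_⟩
    filter_upwards [ha, hu.mem_nhds hx] with y h1 h2
    rw [hfg y h2, h1]

/-- The groupoid of local homeomorphisms of affine space that are, together with their inverses,
locally affine; equivalently, affine on each connected component of their domain. -/
def affineGroupoid (d : ℕ) : StructureGroupoid (AffSpace d) :=
  (affinePregroupoid d).groupoid

/-- An affine manifold of dimension `d`: the transition maps of the atlas are locally affine. -/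
abbrev AffineManifold (d : ℕ) (X : Type*) [TopologicalSpace X] [ChartedSpace (AffSpace d) X] :
    Prop :=
  HasGroupoid X (affineGroupoid d)

theorem affineGroupoid_le_contDiffGroupoid (d : ℕ) :
    affineGroupoid d ≤ contDiffGroupoid ∞ 𝓘(ℝ, AffSpace d) := by
  have key : ∀ (f : AffSpace d → AffSpace d) (s : Set (AffSpace d)),
      (affinePregroupoid d).property f s → ContDiffOn ℝ ∞ f s := by
    intro f s h x hx
    obtain ⟨a, ha⟩ := h x hx
    have h1 : ContDiffAt ℝ ∞ (fun y => a y) x := by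
      let b : AffSpace d →ᴬ[ℝ] AffSpace d :=
        ⟨a.toAffineMap, AffineMap.continuous_of_finiteDimensional _⟩
      exact (ContinuousAffineMap.contDiff b).contDiffAt
    exact (h1.congr_of_eventuallyEq ha).contDiffWithinAt
  intro e he
  obtain ⟨h1, h2⟩ := mem_groupoid_of_pregroupoid.1 he
  refine mem_groupoid_of_pregroupoid.2 ⟨?_, ?_⟩
  · simpa [contDiffPregroupoid] using key _ _ h1
  · simpa [contDiffPregroupoid] using key _ _ h2

/-- An affine manifold is a smooth manifold for the same atlas. -/
theorem AffineManifold.isManifold (d : ℕ) (X : Type*) [TopologicalSpace X]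
    [ChartedSpace (AffSpace d) X] [AffineManifold d X] :
    IsManifold 𝓘(ℝ, AffSpace d) ∞ X :=
  { hasGroupoid_of_le (G₁ := affineGroupoid d) inferInstance
      (affineGroupoid_le_contDiffGroupoid d) with }

/-- A local affine isomorphism between affine manifolds of the same dimension: a continuous map
which, read in charts, coincides near each point with an affine automorphism. -/
def IsAffineLocalIso (d : ℕ) {X Y : Type*} [TopologicalSpace X] [ChartedSpace (AffSpace d) X]
    [TopologicalSpace Y] [ChartedSpace (AffSpace d) Y] (f : X → Y) : Prop :=
  Continuous f ∧
    ∀ x : X, ∀ e ∈ atlas (AffSpace d) X, ∀ e' ∈ atlas (AffSpace d) Y,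
      x ∈ e.source → f x ∈ e'.source →
        ∃ g : AffGroup d, ∀ᶠ y in 𝓝 x, e' (f y) = g (e y)

/-- `p : X → M` is the universal cover of the affine manifold `M`, with the affine structure
lifted from `M`. -/
structure IsUniversalAffineCover (d : ℕ) {X M : Type*} [TopologicalSpace X]
    [ChartedSpace (AffSpace d) X] [TopologicalSpace M] [ChartedSpace (AffSpace d) M]
    (p : X → M) : Prop where
  simplyConnected : SimplyConnectedSpace X
  isCoveringMap : IsCoveringMap p
  isAffineLocalIso : IsAffineLocalIso d p

/-- The group of deck transformations of `p : X → M`. When `p` is the universal cover of a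
connected manifold, it is the fundamental group of `M` acting on `X`. -/
def deckGroup {X M : Type*} [TopologicalSpace X] (p : X → M) : Subgroup (X ≃ₜ X) where
  carrier := {γ | ∀ x, p (γ x) = p x}
  mul_mem' := by
    intro a b ha hb x
    exact (ha (b x)).trans (hb x)
  one_mem' := fun _ => rfl
  inv_mem' := by
    intro a ha x
    have h := ha (a⁻¹ x)
    rw [show a (a⁻¹ x) = x from a.apply_symm_apply x] at h
    exact h.symm

/-- A developing pair `(dev, hol)` for the affine manifold `M` with universal cover `p : X → M`:
the developing map is a local affine isomorphism from `X` to affine space, equivariant with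
respect to the holonomy homomorphism. -/
structure IsDevelopingPair (d : ℕ) {X M : Type*} [TopologicalSpace X]
    [ChartedSpace (AffSpace d) X] (p : X → M) (dev : X → AffSpace d)
    (hol : deckGroup p →* AffGroup d) : Prop where
  isAffineLocalIso : IsAffineLocalIso d dev
  equivariant : ∀ (γ : deckGroup p) (x : X), dev (γ.1 x) = hol γ (dev x)

/-- The group `H` of affine automorphisms preserves the parallel (that is, constant) vector field
`v` on affine space: the differential of each `h ∈ H` fixes `v`. -/
def PreservesParallelField {d : ℕ} (H : Subgroup (AffGroup d)) (v : AffSpace d) : Prop :=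
  ∀ h ∈ H, h.linear v = v

/-- A vector field on an affine manifold is parallel if it is locally constant when read in any
affine chart. -/
def IsParallelVectorField (d : ℕ) {X : Type*} [TopologicalSpace X] [ChartedSpace (AffSpace d) X]
    (V : (x : X) → TangentSpace 𝓘(ℝ, AffSpace d) x) : Prop :=
  ∀ e ∈ atlas (AffSpace d) X, ∀ x ∈ e.source, ∀ᶠ y in 𝓝 x,
    NormedSpace.fromTangentSpace (𝕜 := ℝ) (e y)
        (mfderiv 𝓘(ℝ, AffSpace d) 𝓘(ℝ, AffSpace d) e y (V y)) =
      NormedSpace.fromTangentSpace (𝕜 := ℝ) (e x)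
        (mfderiv 𝓘(ℝ, AffSpace d) 𝓘(ℝ, AffSpace d) e x (V x))

/-- A complete parallel flow on an affine manifold: a smooth action of `ℝ` whose orbit maps are
the integral curves of a nowhere vanishing parallel vector field. -/
def IsCompleteParallelFlow (d : ℕ) {X : Type*} [TopologicalSpace X]
    [ChartedSpace (AffSpace d) X] (Θ : Flow ℝ X) : Prop :=
  ContMDiff (𝓘(ℝ, ℝ).prod 𝓘(ℝ, AffSpace d)) 𝓘(ℝ, AffSpace d) ∞ (fun z : ℝ × X => Θ z.1 z.2) ∧
    ∃ V : (x : X) → TangentSpace 𝓘(ℝ, AffSpace d) x,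
      IsParallelVectorField d V ∧ (∀ x, V x ≠ 0) ∧
        ∀ x, IsMIntegralCurve (I := 𝓘(ℝ, AffSpace d)) (fun t => Θ t x) V

/-- The set `W` is open, and `f` restricts to a smooth diffeomorphism from `W` onto the open set
`f '' W`. -/
def IsDiffeoOntoImageOn {E E' H H' : Type*} [NormedAddCommGroup E] [NormedSpace ℝ E]
    [NormedAddCommGroup E'] [NormedSpace ℝ E'] [TopologicalSpace H] [TopologicalSpace H']
    (I : ModelWithCorners ℝ E H) (J : ModelWithCorners ℝ E' H')
    {X Y : Type*} [TopologicalSpace X] [ChartedSpace H X] [TopologicalSpace Y]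
    [ChartedSpace H' Y] (f : X → Y) (W : Set X) : Prop :=
  ∃ φ : PartialDiffeomorph I J X Y ∞, φ.source = W ∧ EqOn f φ W

/-! Near any point of the cover, short segments in direction `v` lift through the local
homeomorphism `dev`. Holonomy fixes `v`, so deck transformations carry such lifts to such lifts;
they are transitive on fibres, so the admissible length depends only on the point of `M`.
Compactness of `M` then makes it uniform, and concatenating lifts gives every length
(`liftsSegment_of_isDevelopingPair`). Uniqueness and continuity of lifts assemble them into a flow
over translation by `t • v` (`IsLocalHomeomorph.exists_flow`).

In coordinates sending `v` to `(1, 0)`, the first coordinate of `dev` grows at unit speed along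
orbits. Its zero set therefore meets each orbit exactly once, which splits the cover as time axis
times transversal and `dev` as identity times a local diffeomorphism. Injectivity of the transverse
factor on `U` gives injectivity of `dev` on the saturation of `U` (`exists_flow_trivialization`). -/

open unitInterval in
/-- The affine segment from `f x` to `f x + w` lifts through `f` to a path starting at `x`. -/
def LiftsSegment {X E : Type*} [TopologicalSpace X] [NormedAddCommGroup E] [NormedSpace ℝ E]
    (f : X → E) (x : X) (w : E) : Prop :=
  ∃ (y : X) (Γ : Path x y), ∀ s : I, f (Γ s) = f x + (s : ℝ) • w

/-! ### Lifting segments and building the flow -/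

section Lifting

variable {X E : Type*} [TopologicalSpace X] [NormedAddCommGroup E] [NormedSpace ℝ E] {f : X → E}

theorem LiftsSegment.two_smul {w : E} (h : ∀ x, LiftsSegment f x w) (x : X) :
    LiftsSegment f x ((2 : ℝ) • w) := by
  obtain ⟨y, Γ, hΓ⟩ := h x
  obtain ⟨z, Δ, hΔ⟩ := h y
  have hy : f y = f x + w := by simpa using hΓ 1
  refine ⟨z, Γ.trans Δ, fun s => ?_⟩
  rw [Path.trans_apply]
  split_ifs with hs
  · rw [hΓ, smul_smul, mul_comm (s : ℝ)]
  · rw [hΔ, hy, add_assoc, smul_smul, add_right_inj]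
    simp only [sub_smul, one_smul]
    rw [mul_comm (s : ℝ)]
    abel

/-- Since `ε` does not depend on the point, a lift can be continued from its endpoint, so the
admissible length doubles each time. -/
theorem LiftsSegment.of_small {v : E} {ε : ℝ} (hε : 0 < ε)
    (h : ∀ t : ℝ, |t| < ε → ∀ x, LiftsSegment f x (t • v)) (t : ℝ) (x : X) :
    LiftsSegment f x (t • v) := by
  have key : ∀ (k : ℕ) (t : ℝ), |t| < 2 ^ k * ε → ∀ x, LiftsSegment f x (t • v) := by
    intro k
    induction k with
    | zero => simpa using h
    | succ k ih =>
      intro t ht x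
      have h2 : |t / 2| < 2 ^ k * ε := by
        rw [abs_div, abs_two, div_lt_iff₀ two_pos]
        calc |t| < 2 ^ (k + 1) * ε := ht
          _ = _ := by ring
      have := LiftsSegment.two_smul (ih (t / 2) h2) x
      rwa [smul_smul, mul_div_cancel₀ t two_ne_zero] at this
  obtain ⟨k, hk⟩ := pow_unbounded_of_one_lt (|t| / ε) one_lt_two
  exact key k t ((div_lt_iff₀ hε).1 hk) x

theorem IsLocalHomeomorph.eventually_liftsSegment (hf : IsLocalHomeomorph f) (v : E) (x₀ : X) :
    ∃ ε > 0, ∀ᶠ x in 𝓝 x₀, ∀ t : ℝ, |t| < ε → LiftsSegment f x (t • v) := by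
  obtain ⟨φ, hx₀, rfl⟩ := hf x₀
  obtain ⟨r, hr, hball⟩ :=
    Metric.isOpen_iff.1 φ.open_target (φ x₀) (φ.map_source hx₀)
  -- Half of the radius pays for moving the starting point, half for the segment; the `+ 1` covers
  -- `v = 0`.
  refine ⟨r / 2 / (‖v‖ + 1), by positivity, ?_⟩
  filter_upwards [φ.open_source.mem_nhds hx₀,
    (φ.continuousAt hx₀).eventually (Metric.ball_mem_nhds (φ x₀) (half_pos hr))] with x hx hxr t ht
  have hmem : ∀ s : unitInterval, φ x + (s : ℝ) • t • v ∈ φ.target := by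
    intro s
    apply hball
    have h1 : ‖(s : ℝ) • t • v‖ ≤ r / 2 := by
      rw [norm_smul, norm_smul, Real.norm_eq_abs, Real.norm_eq_abs, abs_of_nonneg s.2.1]
      have h2 : |t| * (‖v‖ + 1) < r / 2 := (lt_div_iff₀ (by positivity)).1 ht
      have h3 := s.2.2
      have h4 : 0 ≤ |t| * ‖v‖ := by positivity
      nlinarith [abs_nonneg t]
    rw [Metric.mem_ball, dist_eq_norm] at *
    calc ‖φ x + (s : ℝ) • t • v - φ x₀‖ = ‖(φ x - φ x₀) + (s : ℝ) • t • v‖ := by congr 1; abel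
      _ ≤ ‖φ x - φ x₀‖ + ‖(s : ℝ) • t • v‖ := norm_add_le _ _
      _ < r := by linarith
  refine ⟨_, ⟨⟨fun s => φ.symm (φ x + (s : ℝ) • t • v), ?_⟩, ?_, rfl⟩, fun s => ?_⟩
  · exact φ.continuousOn_symm.comp_continuous (by fun_prop) hmem
  · simp [φ.left_inv hx]
  · exact φ.right_inv (hmem s)

/-- If all segments in direction `v` lift through a local homeomorphism `f` with Hausdorff source,
the lifts fit together to a flow covering the translations by multiples of `v`. -/
theorem IsLocalHomeomorph.exists_flow [T2Space X] (hf : IsLocalHomeomorph f) {v : E}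
    (h : ∀ (t : ℝ) (x : X), LiftsSegment f x (t • v)) :
    ∃ Θ : Flow ℝ X, ∀ t x, f (Θ t x) = f x + t • v := by
  choose θ Γ hΓ using h
  have hθ : ∀ t x, f (θ t x) = f x + t • v := fun t x => by simpa using hΓ t x 1
  have sep : IsSeparatedMap f := T2Space.isSeparatedMap f
  -- Joint continuity in time, parameter and starting point: the lifts are continuous along each
  -- path, and their initial points vary continuously.
  have hlift : Continuous fun z : unitInterval × (ℝ × X) => Γ z.2.1 z.2.2 z.1 := by
    refine hf.continuous_lift sep
      ⟨fun z : unitInterval × (ℝ × X) => f z.2.2 + (z.1 : ℝ) • z.2.1 • v, ?_⟩ ?_ ?_ ?_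
    · have := hf.continuous
      fun_prop
    · ext z
      exact hΓ z.2.1 z.2.2 z.1
    · simpa using continuous_snd
    · intro a
      exact (Γ a.1 a.2).continuous
  have hcont : Continuous (Function.uncurry θ) := by
    have := hlift.comp (Continuous.prodMk_right (1 : unitInterval))
    simpa [Function.comp_def, Function.uncurry_def] using this
  have hzero : ∀ x, θ 0 x = x := by
    intro x
    have := sep.eq_of_comp_eq hf.isLocallyInjective (Γ 0 x).continuous
      (continuous_const (y := x)) (by ext s; simp [hΓ]) 0 (by simp)
    simpa using congr_fun this 1
  refine ⟨⟨θ, hcont, fun s t x => ?_, hzero⟩, hθ⟩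
  -- Both curves in `s` lift the same line and agree at `s = 0`.
  have := sep.eq_of_comp_eq hf.isLocallyInjective (g₁ := fun s => θ (s + t) x)
    (g₂ := fun s => θ s (θ t x))
    (hcont.comp (f := fun s : ℝ => (s + t, x)) (by fun_prop))
    (hcont.comp (f := fun s : ℝ => (s, θ t x)) (by fun_prop))
    (by ext1 s; simp only [Function.comp_apply, hθ, add_smul]; abel) 0 (by simp [hzero])
  exact congr_fun this s

end Lifting

/-! ### Deck transformations and uniform lifting -/

/-- The deck group of a simply connected, locally path connected cover is transitive on fibres. -/
theorem IsCoveringMap.exists_deckGroup_apply_eq {X M : Type*} [TopologicalSpace X]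
    [TopologicalSpace M] [SimplyConnectedSpace X] [LocallyPathConnectedSpace X] {p : X → M}
    (hp : IsCoveringMap p) {x y : X} (hxy : p x = p y) : ∃ γ : deckGroup p, γ.1 x = y := by
  have lift : ∀ a b, p a = p b → ∃ F : C(X, X), F a = b ∧ p ∘ F = p := fun a b hab =>
    (hp.existsUnique_continuousMap_lifts ⟨p, hp.continuous⟩ a b hab.symm).exists
  obtain ⟨F, hF, hpF⟩ := lift x y hxy
  obtain ⟨G, hG, hpG⟩ := lift y x hxy.symm
  have hGF : G ∘ F = id := hp.eq_of_comp_eq (G.continuous.comp F.continuous) continuous_id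
    (by rw [← Function.comp_assoc, hpG, hpF]; rfl) x (by simp [hF, hG])
  have hFG : F ∘ G = id := hp.eq_of_comp_eq (F.continuous.comp G.continuous) continuous_id
    (by rw [← Function.comp_assoc, hpF, hpG]; rfl) y (by simp [hF, hG])
  exact ⟨⟨⟨⟨F, G, congr_fun hGF, congr_fun hFG⟩, F.continuous, G.continuous⟩, congr_fun hpF⟩, hF⟩

/-- A covering of a Hausdorff space is Hausdorff. -/
theorem IsCoveringMap.t2Space {X M : Type*} [TopologicalSpace X] [TopologicalSpace M] [T2Space M]
    {p : X → M} (hp : IsCoveringMap p) : T2Space X := by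
  refine ⟨fun x y hxy => ?_⟩
  by_cases h : p x = p y
  · exact hp.isSeparatedMap x y h hxy
  · exact separated_by_continuous hp.continuous h

/-- Segments lift in a parallel direction: by compactness of the base and equivariance, short
segments lift uniformly over the whole cover. -/
theorem liftsSegment_of_isDevelopingPair {d : ℕ} {M X : Type*} [TopologicalSpace M]
    [CompactSpace M] [TopologicalSpace X] [ChartedSpace (AffSpace d) X]
    [SimplyConnectedSpace X] [LocallyPathConnectedSpace X]
    {p : X → M} (hp : IsCoveringMap p)
    {dev : X → AffSpace d} (hloc : IsLocalHomeomorph dev) {hol : deckGroup p →* AffGroup d}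
    (hdev : IsDevelopingPair d p dev hol) {v : AffSpace d}
    (hhol : PreservesParallelField hol.range v) (t : ℝ) (x : X) :
    LiftsSegment dev x (t • v) := by
  have htrans : ∀ (γ : deckGroup p) (t : ℝ) (x : X), LiftsSegment dev x (t • v) →
      LiftsSegment dev (γ.1 x) (t • v) := by
    rintro γ t x ⟨y, Γ, hΓ⟩
    refine ⟨γ.1 y, Γ.map γ.1.continuous, fun s => ?_⟩
    rw [Path.map_coe, Function.comp_apply, hdev.equivariant, hdev.equivariant, hΓ]
    have h1 := (hol γ).map_vadd (dev x) ((s : ℝ) • t • v)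
    rw [map_smul, map_smul, hhol _ ⟨γ, rfl⟩, vadd_eq_add, vadd_eq_add] at h1
    rw [add_comm (dev x), h1, add_comm]
  have hlocal : ∀ m : M, ∃ ε > 0, ∀ᶠ m' in 𝓝 m, ∀ x, p x = m' →
      ∀ t : ℝ, |t| < ε → LiftsSegment dev x (t • v) := by
    intro m
    by_cases hm : ∃ x, p x = m
    · obtain ⟨x₀, rfl⟩ := hm
      obtain ⟨ε, hε, hx₀⟩ := hloc.eventually_liftsSegment v x₀
      refine ⟨ε, hε, ?_⟩
      filter_upwards [hp.isOpenMap.image_mem_nhds hx₀]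
      rintro _ ⟨x, hx, rfl⟩ y hy t ht
      obtain ⟨γ, rfl⟩ := hp.exists_deckGroup_apply_eq hy.symm
      exact htrans γ t x (hx t ht)
    -- A covering map need not be surjective here; over an evenly covered neighbourhood of a point
    -- with empty fibre there is nothing to lift.
    · obtain ⟨-, U, hmU, hU, -, H, -⟩ := hp m
      refine ⟨1, one_pos, ?_⟩
      filter_upwards [hU.mem_nhds hmU]
      rintro _ hx x rfl
      exact absurd ⟨_, (H ⟨x, hx⟩).2.2⟩ hm
  choose ε hε hU using hlocal
  obtain ⟨s, -, hs⟩ := isCompact_univ.elim_nhds_subcover _ fun m _ => hU m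
  have hmin : ∃ δ > 0, ∀ m ∈ s, δ ≤ ε m := by
    rcases s.eq_empty_or_nonempty with rfl | hne
    · exact ⟨1, one_pos, by simp⟩
    · exact ⟨s.inf' hne ε, (Finset.lt_inf'_iff hne).2 fun m _ => hε m,
        fun m hm => Finset.inf'_le _ hm⟩
  obtain ⟨δ, hδ, hδs⟩ := hmin
  refine LiftsSegment.of_small hδ (fun t ht x => ?_) t x
  obtain ⟨m, hm, hxm⟩ := mem_iUnion₂.1 (hs (mem_univ (p x)))
  exact hxm x rfl t (ht.trans_le (hδs m hm))

/-! ### Local diffeomorphisms -/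

section LocalDiffeomorph

variable {𝕜 : Type*} [NontriviallyNormedField 𝕜]
  {E E' E'' : Type*} [NormedAddCommGroup E] [NormedSpace 𝕜 E] [NormedAddCommGroup E']
  [NormedSpace 𝕜 E'] [NormedAddCommGroup E''] [NormedSpace 𝕜 E'']
  {H H' H'' : Type*} [TopologicalSpace H] [TopologicalSpace H'] [TopologicalSpace H'']
  {I : ModelWithCorners 𝕜 E H} {J : ModelWithCorners 𝕜 E' H'} {K : ModelWithCorners 𝕜 E'' H''}
  {X Y Z : Type*} [TopologicalSpace X] [ChartedSpace H X] [TopologicalSpace Y]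
  [ChartedSpace H' Y] [TopologicalSpace Z] [ChartedSpace H'' Z] {k : ℕ∞ω}

/-- The restriction of a partial diffeomorphism to an open set. -/
def PartialDiffeomorph.restrOpen (φ : PartialDiffeomorph I J X Y k) (s : Set X) (hs : IsOpen s) :
    PartialDiffeomorph I J X Y k where
  __ := φ.toOpenPartialHomeomorph.restrOpen s hs
  contMDiffOn_toFun := φ.contMDiffOn_toFun.mono inter_subset_left
  contMDiffOn_invFun := φ.contMDiffOn_invFun.mono inter_subset_left

theorem IsLocalDiffeomorphAt.congr_of_eventuallyEq {f g : X → Y} {x : X}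
    (hf : IsLocalDiffeomorphAt I J k f x) (hfg : g =ᶠ[𝓝 x] f) :
    IsLocalDiffeomorphAt I J k g x := by
  obtain ⟨φ, hx, hφ⟩ := hf
  obtain ⟨s, hs, hso, hxs⟩ := eventually_nhds_iff.1 hfg
  exact ⟨φ.restrOpen s hso, ⟨hx, hxs⟩, fun y hy => (hs y hy.2).trans (hφ hy.1)⟩

theorem isLocalDiffeomorphAt_of_mem_atlas [IsManifold I k X] {e : OpenPartialHomeomorph X H}
    (he : e ∈ atlas H X) {x : X} (hx : x ∈ e.source) : IsLocalDiffeomorphAt I I k e x :=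
  ⟨{ toPartialEquiv := e.toPartialEquiv
     open_source := e.open_source
     open_target := e.open_target
     contMDiffOn_toFun := contMDiffOn_of_mem_maximalAtlas (IsManifold.subset_maximalAtlas he)
     contMDiffOn_invFun :=
      contMDiffOn_symm_of_mem_maximalAtlas (IsManifold.subset_maximalAtlas he) },
    hx, fun _ _ => rfl⟩

/-- A continuous lift of a `C^k` map through a local diffeomorphism is `C^k`. -/
theorem IsLocalDiffeomorph.contMDiff_of_comp {f : X → Y} (hf : IsLocalDiffeomorph I J k f)
    {g : Z → X} (hg : Continuous g) (hfg : ContMDiff K J k (f ∘ g)) : ContMDiff K I k g := by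
  intro z
  have h1 := ((hf (g z)).localInverse_contMDiffAt).comp (g := _) (f := f ∘ g) z (hfg z)
  have h2 : ∀ᶠ w in 𝓝 z, ((hf (g z)).localInverse ∘ f) (g w) = id (g w) :=
    hg.continuousAt.eventually (hf (g z)).localInverse_eventuallyEq_left
  exact h1.congr_of_eventuallyEq (h2.mono fun _ h => h.symm)

/-- A local diffeomorphism restricts to a diffeomorphism on every open set on which it is
injective. -/
theorem IsLocalDiffeomorph.isDiffeoOntoImageOn {E E' H H' : Type*} [NormedAddCommGroup E]
    [NormedSpace ℝ E] [NormedAddCommGroup E'] [NormedSpace ℝ E'] [TopologicalSpace H]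
    [TopologicalSpace H'] {I : ModelWithCorners ℝ E H} {J : ModelWithCorners ℝ E' H'}
    {X Y : Type*} [TopologicalSpace X] [ChartedSpace H X] [TopologicalSpace Y]
    [ChartedSpace H' Y] [Nonempty X] {f : X → Y} (hf : IsLocalDiffeomorph I J ∞ f) {W : Set X}
    (hW : IsOpen W) (hinj : InjOn f W) : IsDiffeoOntoImageOn I J f W := by
  refine ⟨{ hinj.toPartialEquiv with
            open_source := hW
            open_target := hf.isOpenMap W hW
            contMDiffOn_toFun := hf.contMDiff.contMDiffOn
            contMDiffOn_invFun := ?_ }, rfl, fun _ _ => rfl⟩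
  rintro _ ⟨x, hx, rfl⟩
  have h1 := (hf x).localInverse_contMDiffAt
  refine (h1.congr_of_eventuallyEq ?_).contMDiffWithinAt
  have hx' : (hf x).localInverse (f x) = x :=
    (hf x).localInverse_left_inv (hf x).localInverse_mem_target
  have h2 : ∀ᶠ y in 𝓝 (f x), (hf x).localInverse y ∈ W :=
    h1.continuousAt.eventually (by rw [hx']; exact hW.mem_nhds hx)
  filter_upwards [h2, (hf x).localInverse_eventuallyEq_right] with y hy hy'
  have hy'' : f ((hf x).localInverse y) = y := hy'
  have hyW : y ∈ f '' W := ⟨_, hy, hy''⟩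
  -- The global inverse and the smooth local inverse give two points of `W` with the same image, so
  -- they coincide near `f x`.
  exact hinj (Function.invFunOn_mem hyW) hy ((Function.invFunOn_eq hyW).trans hy''.symm)

end LocalDiffeomorph

/-! ### Manifold structure pulled back by a local homeomorphism -/

section PulledBackCharts

variable {H N : Type*} [TopologicalSpace H] [TopologicalSpace N] {f : N → H}

/-- The charted space structure whose charts are the restrictions of a local homeomorphism to the
model space. -/
noncomputable abbrev IsLocalHomeomorph.comapChartedSpace (hf : IsLocalHomeomorph f) :
    ChartedSpace H N where
  atlas := {e | f = e}
  chartAt x := (hf x).choose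
  mem_chart_source x := (hf x).choose_spec.1
  chart_mem_atlas x := (hf x).choose_spec.2

/-- All charts are restrictions of the single map `f`, so every transition map is the identity on an
open set. -/
theorem IsLocalHomeomorph.hasGroupoid_comapChartedSpace (hf : IsLocalHomeomorph f)
    (G : StructureGroupoid H)
    [ClosedUnderRestriction G] : @HasGroupoid H _ N _ hf.comapChartedSpace G := by
  let _ := hf.comapChartedSpace
  refine ⟨fun {e e'} he he' => ?_⟩
  refine (closedUnderRestriction_iff_id_le G).1 inferInstance
    ⟨(e.symm ≫ₕ e').source, (e.symm ≫ₕ e').open_source, rfl, fun y hy => ?_⟩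
  have hf : ⇑e' = e := Eq.trans (Eq.symm he') he
  have hy1 : y ∈ e.target := hy.1
  simp [hf, e.right_inv hy1]

theorem IsLocalHomeomorph.isManifold_comapChartedSpace {𝕜 E : Type*}
    [NontriviallyNormedField 𝕜]
    [NormedAddCommGroup E] [NormedSpace 𝕜 E] (I : ModelWithCorners 𝕜 E H) (k : ℕ∞ω)
    (hf : IsLocalHomeomorph f) : @IsManifold 𝕜 _ E _ _ H _ I k N _ hf.comapChartedSpace :=
  let _ := hf.comapChartedSpace
  { hf.hasGroupoid_comapChartedSpace (contDiffGroupoid k I) with }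

theorem IsLocalHomeomorph.isLocalDiffeomorph_comapChartedSpace {𝕜 E : Type*}
    [NontriviallyNormedField 𝕜]
    [NormedAddCommGroup E] [NormedSpace 𝕜 E] (I : ModelWithCorners 𝕜 E H) (k : ℕ∞ω)
    (hf : IsLocalHomeomorph f) :
    @IsLocalDiffeomorph 𝕜 _ E _ _ E _ _ H _ H _ I I N _ hf.comapChartedSpace H _ _ k f := by
  let _ := hf.comapChartedSpace
  have := hf.isManifold_comapChartedSpace I k
  intro x
  have h := isLocalDiffeomorphAt_of_mem_atlas (I := I) (k := k) (chart_mem_atlas H x)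
    (mem_chart_source H x)
  rwa [show ⇑(chartAt H x) = f from (chart_mem_atlas H x).symm] at h

end PulledBackCharts

/-! ### Local affine isomorphisms and parallel flows -/

section AffineLocalIso

variable {d : ℕ} {X : Type*} [TopologicalSpace X] [ChartedSpace (AffSpace d) X]
  {f : X → AffSpace d}

theorem IsAffineLocalIso.exists_eventuallyEq (hf : IsAffineLocalIso d f) {x : X}
    {e : OpenPartialHomeomorph X (AffSpace d)} (he : e ∈ atlas (AffSpace d) X)
    (hx : x ∈ e.source) : ∃ g : AffGroup d, ∀ᶠ y in 𝓝 x, f y = g (e y) :=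
  hf.2 x e he (OpenPartialHomeomorph.refl _) rfl hx trivial

/-- An affine equivalence of finite-dimensional spaces as a diffeomorphism. -/
noncomputable def AffineEquiv.toDiffeomorphOfFiniteDimensional {E F : Type*}
    [NormedAddCommGroup E] [NormedSpace ℝ E] [FiniteDimensional ℝ E] [NormedAddCommGroup F]
    [NormedSpace ℝ F] [FiniteDimensional ℝ F] (g : E ≃ᵃ[ℝ] F) :
    Diffeomorph 𝓘(ℝ, E) 𝓘(ℝ, F) E F ∞ where
  toEquiv := g.toEquiv
  contMDiff_toFun := ContDiff.contMDiff <| ContinuousAffineMap.contDiff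
    (⟨g.toAffineMap, AffineMap.continuous_of_finiteDimensional _⟩ : E →ᴬ[ℝ] F)
  contMDiff_invFun := ContDiff.contMDiff <| ContinuousAffineMap.contDiff
    (⟨g.symm.toAffineMap, AffineMap.continuous_of_finiteDimensional _⟩ : F →ᴬ[ℝ] E)

theorem IsAffineLocalIso.isLocalDiffeomorph [AffineManifold d X] (hf : IsAffineLocalIso d f) :
    IsLocalDiffeomorph 𝓘(ℝ, AffSpace d) 𝓘(ℝ, AffSpace d) ∞ f := by
  have := AffineManifold.isManifold d X
  intro x
  obtain ⟨g, hg⟩ := hf.exists_eventuallyEq (chart_mem_atlas (AffSpace d) x)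
    (mem_chart_source _ x)
  have h1 := isLocalDiffeomorphAt_of_mem_atlas (I := 𝓘(ℝ, AffSpace d)) (k := ∞)
    (chart_mem_atlas (AffSpace d) x) (mem_chart_source _ x)
  exact (h1.comp (K := 𝓘(ℝ, AffSpace d)) (P := AffSpace d)
    (g.toDiffeomorphOfFiniteDimensional.isLocalDiffeomorph _)).congr_of_eventuallyEq hg

end AffineLocalIso

/-- The generator is the pullback of `v` by `f`. In a chart `e` with `f = g ∘ e` locally it reads as
the constant `g.linear.symm v`, and smoothness of the flow lifts from that of `f x + t • v`. -/
theorem IsAffineLocalIso.isCompleteParallelFlow {d : ℕ} {X : Type*} [TopologicalSpace X]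
    [ChartedSpace (AffSpace d) X] [AffineManifold d X] {f : X → AffSpace d}
    (hf : IsAffineLocalIso d f) {v : AffSpace d} (hv : v ≠ 0) {Θ : Flow ℝ X}
    (hΘ : ∀ t x, f (Θ t x) = f x + t • v) : IsCompleteParallelFlow d Θ := by
  have hloc := hf.isLocalDiffeomorph
  have hsmooth : ContMDiff (𝓘(ℝ, ℝ).prod 𝓘(ℝ, AffSpace d)) 𝓘(ℝ, AffSpace d) ∞
      (fun z : ℝ × X => Θ z.1 z.2) := by
    refine hloc.contMDiff_of_comp (Θ.continuous continuous_fst continuous_snd) ?_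
    have h1 : (f ∘ fun z : ℝ × X => Θ z.1 z.2) = fun z => f z.2 + z.1 • v := by
      ext1 z
      exact hΘ _ _
    rw [h1]
    exact (hloc.contMDiff.comp contMDiff_snd).add (contMDiff_fst.smul contMDiff_const)
  let D := fun x => hloc.mfderivToContinuousLinearEquiv (by simp) x
  have hD : ∀ x w, D x w = mfderiv 𝓘(ℝ, AffSpace d) 𝓘(ℝ, AffSpace d) f x w := fun x w => rfl
  refine ⟨hsmooth, fun x => (D x).symm ((NormedSpace.fromTangentSpace (𝕜 := ℝ) (f x)).symm v),
    ?_, ?_, ?_⟩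
  · intro e he x hx
    have := AffineManifold.isManifold d X
    obtain ⟨g, hg⟩ := hf.exists_eventuallyEq he hx
    have key : ∀ y ∈ e.source, (∀ᶠ z in 𝓝 y, f z = g (e z)) → ∀ w,
        mfderiv 𝓘(ℝ, AffSpace d) 𝓘(ℝ, AffSpace d) f y w =
          g.linear (mfderiv 𝓘(ℝ, AffSpace d) 𝓘(ℝ, AffSpace d) e y w) := by
      intro y hy hgy w
      let b : AffSpace d →ᴬ[ℝ] AffSpace d :=
        ⟨g.toAffineMap, AffineMap.continuous_of_finiteDimensional _⟩
      have he' : MDifferentiableAt 𝓘(ℝ, AffSpace d) 𝓘(ℝ, AffSpace d) e y :=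
        (isLocalDiffeomorphAt_of_mem_atlas (k := ∞) he hy).mdifferentiableAt (by simp)
      have hfe : f =ᶠ[𝓝 y] b ∘ e := hgy
      rw [hfe.mfderiv_eq]
      exact congr($((b.hasFDerivAt.hasMFDerivAt.comp y he'.hasMFDerivAt).mfderiv) w)
    have hconst : ∀ y ∈ e.source, (∀ᶠ z in 𝓝 y, f z = g (e z)) →
        NormedSpace.fromTangentSpace (𝕜 := ℝ) (e y)
          (mfderiv 𝓘(ℝ, AffSpace d) 𝓘(ℝ, AffSpace d) e y
            ((D y).symm ((NormedSpace.fromTangentSpace (𝕜 := ℝ) (f y)).symm v))) =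
          g.linear.symm v := by
      intro y hy hgy
      rw [LinearEquiv.eq_symm_apply]
      refine (key y hy hgy _).symm.trans ?_
      rw [← hD, ContinuousLinearEquiv.apply_symm_apply]
      rfl
    filter_upwards [e.open_source.mem_nhds hx, hg.eventually_nhds] with y hy hgy
    rw [hconst y hy hgy, hconst x hx hg]
  · intro x hx
    exact hv ((D x).symm.map_eq_zero_iff.1 hx)
  · intro x t
    have hΘx : MDifferentiableAt 𝓘(ℝ, ℝ) 𝓘(ℝ, AffSpace d) (fun t => Θ t x) t :=
      (hsmooth.comp (contMDiff_id.prodMk contMDiff_const)).mdifferentiableAt (by simp)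
    have h1 := ((hloc (Θ t x)).mdifferentiableAt (by simp)).hasMFDerivAt.comp t hΘx.hasMFDerivAt
    have h2 : HasFDerivAt (f ∘ fun t => Θ t x) ((1 : ℝ →L[ℝ] ℝ).smulRight v) t := by
      rw [show (f ∘ fun t => Θ t x) = fun t => f x + t • v from funext fun t => hΘ t x]
      exact ((hasFDerivAt_id t).smul_const v).const_add (f x)
    -- The derivative of `f (Θ t x)` in `t`, by the chain rule and by the explicit formula;
    -- inverting `D` isolates the velocity of the orbit.
    have h3 := hasMFDerivAt_unique h1 h2.hasMFDerivAt
    have h4 : mfderiv 𝓘(ℝ, ℝ) 𝓘(ℝ, AffSpace d) (fun t => Θ t x) t =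
        (1 : ℝ →L[ℝ] ℝ).smulRight
          ((D (Θ t x)).symm ((NormedSpace.fromTangentSpace (𝕜 := ℝ) (f (Θ t x))).symm v)) := by
      refine ContinuousLinearMap.ext fun s => (D (Θ t x)).injective ?_
      refine congr($h3 s).trans ?_
      refine Eq.symm (((D (Θ t x)).map_smul s _).trans ?_)
      rw [ContinuousLinearEquiv.apply_symm_apply]
      rfl
    rw [← h4]
    exact hΘx.hasMFDerivAt

/-! ### Product structure of the flow -/

theorem exists_affineEquiv_linear_apply_eq {n : ℕ} {v : AffSpace (n + 1)} (hv : v ≠ 0) :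
    ∃ A : AffSpace (n + 1) ≃ᵃ[ℝ] ℝ × AffSpace n, A.linear v = (1, 0) := by
  let L : AffSpace (n + 1) ≃ₗ[ℝ] ℝ × AffSpace n := LinearEquiv.ofFinrankEq _ _ (by simp [add_comm])
  obtain ⟨B, hB⟩ := SeparatingDual.exists_continuousLinearEquiv_apply_eq (R := ℝ) hv
    (y := L.symm (1, 0)) (by simp)
  exact ⟨(B.toLinearEquiv.trans L).toAffineEquiv, (congrArg L hB).trans (L.apply_symm_apply _)⟩

/-- If a local diffeomorphism `f` intertwines a flow with a translation flow, then the source is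
the product of the time axis and a transversal, and `f` is the product of the identity of the time
axis and a local diffeomorphism of the transversal. -/
theorem exists_flow_trivialization {n : ℕ} {X : Type w} [TopologicalSpace X]
    [ChartedSpace (AffSpace (n + 1)) X] [Nonempty X] {f : X → AffSpace (n + 1)}
    (hf : IsLocalDiffeomorph 𝓘(ℝ, AffSpace (n + 1)) 𝓘(ℝ, AffSpace (n + 1)) ∞ f)
    {v : AffSpace (n + 1)} {Θ : Flow ℝ X} (hΘ : ∀ t x, f (Θ t x) = f x + t • v)
    (A : AffSpace (n + 1) ≃ᵃ[ℝ] ℝ × AffSpace n) (hA : A.linear v = (1, 0)) :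
    ∃ (N : Type w) (_ : TopologicalSpace N) (_ : ChartedSpace (AffSpace n) N)
      (_ : IsManifold 𝓘(ℝ, AffSpace n) ∞ N)
      (Φ : Diffeomorph 𝓘(ℝ, AffSpace (n + 1)) (𝓘(ℝ, ℝ).prod 𝓘(ℝ, AffSpace n)) X (ℝ × N) ∞)
      (devN : N → AffSpace n),
      (∀ (t : ℝ) (x : X), Φ (Θ t x) = (t + (Φ x).1, (Φ x).2)) ∧
      IsLocalDiffeomorph 𝓘(ℝ, AffSpace n) 𝓘(ℝ, AffSpace n) ∞ devN ∧
      (∀ x : X, (A (f x)).2 = devN (Φ x).2) ∧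
      ∀ U : Set N, IsDiffeoOntoImageOn 𝓘(ℝ, AffSpace n) 𝓘(ℝ, AffSpace n) devN U →
        IsDiffeoOntoImageOn 𝓘(ℝ, AffSpace (n + 1)) 𝓘(ℝ, AffSpace (n + 1)) f
          (Φ ⁻¹' (univ ×ˢ U)) := by
  have hfc : Continuous f := hf.isLocalHomeomorph.continuous
  have hAs := A.toDiffeomorphOfFiniteDimensional.contMDiff
  have hAs' := A.toDiffeomorphOfFiniteDimensional.symm.contMDiff
  have hAc : Continuous A := hAs.continuous
  have hAΘ : ∀ t x, A (f (Θ t x)) = (t + (A (f x)).1, (A (f x)).2) := by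
    intro t x
    have h1 := A.map_vadd (f x) (t • v)
    rw [map_smul, hA, vadd_eq_add, vadd_eq_add] at h1
    rw [hΘ, add_comm (f x), h1]
    ext <;> simp
  -- A global slice: flowing `x` for time `-(A (f x)).1` is the only way to reach it along the
  -- orbit.
  let N := {x : X // (A (f x)).1 = 0}
  let Φ₀ : X ≃ₜ ℝ × N :=
    { toFun := fun x => ((A (f x)).1, ⟨Θ (-(A (f x)).1) x, by simp [hAΘ]⟩)
      invFun := fun z => Θ z.1 z.2.1
      left_inv := fun x => by simp [← Θ.map_add]
      right_inv := by
        rintro ⟨t, y, hy⟩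
        have h1 : (A (f (Θ t y))).1 = t := by simp [hAΘ, hy]
        ext
        · exact h1
        · simp [h1, ← Θ.map_add]
      continuous_toFun := by
        have h1 : Continuous fun x => (A (f x)).1 := (hAc.comp hfc).fst
        exact h1.prodMk ((Θ.continuous h1.neg continuous_id).subtype_mk _)
      continuous_invFun := Θ.continuous continuous_fst (continuous_subtype_val.comp continuous_snd) }
  let devN : N → AffSpace n := fun y => (A (f y)).2
  have hdevN : ∀ x, (A (f x)).2 = devN (Φ₀ x).2 := fun x => by simp [devN, Φ₀, hAΘ]
  have hA_eq : ∀ x, A (f x) = ((Φ₀ x).1, devN (Φ₀ x).2) := fun x => Prod.ext rfl (hdevN x)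
  have hNc : Continuous devN := ((hAc.comp hfc).comp continuous_subtype_val).snd
  -- Openness descends from `X` through the continuous surjection onto the slice.
  have hopen : IsOpenMap devN := by
    have h1 : IsOpenMap fun x => (A (f x)).2 :=
      isOpenMap_snd.comp (A.toDiffeomorphOfFiniteDimensional.toHomeomorph.isOpenMap.comp
        hf.isOpenMap)
    rw [show (fun x => (A (f x)).2) = devN ∘ (Prod.snd ∘ Φ₀) from funext hdevN] at h1
    exact .of_comp (continuous_snd.comp Φ₀.continuous)
      (Prod.snd_surjective.comp Φ₀.surjective) h1
  have hN : IsLocalHomeomorph devN := by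
    refine isLocalHomeomorph_iff_isOpenEmbedding_restrict.2 fun y => ?_
    obtain ⟨U, hU, hyU, hinj⟩ := hf.isLocalHomeomorph.isLocallyInjective y.1
    have hV : IsOpen ((↑) ⁻¹' U : Set N) := hU.preimage continuous_subtype_val
    refine ⟨_, hV.mem_nhds hyU, .of_continuous_injective_isOpenMap
      (hNc.comp continuous_subtype_val) ?_ (hopen.comp hV.isOpenMap_subtype_val)⟩
    -- On the slice the first coordinate is `0`, so equal values of `devN` force equal values of
    -- `f`.
    intro a b hab
    refine Subtype.ext (Subtype.ext (hinj a.2 b.2 (A.injective ?_)))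
    exact Prod.ext (a.1.2.trans b.1.2.symm) hab
  -- The slice takes its smooth structure from `devN`; both directions of `Φ` are then smooth as
  -- continuous lifts of smooth maps through `devN` or `f`.
  let _ := hN.comapChartedSpace
  have hNm := hN.isManifold_comapChartedSpace 𝓘(ℝ, AffSpace n) ∞
  have hNd := hN.isLocalDiffeomorph_comapChartedSpace 𝓘(ℝ, AffSpace n) ∞
  have hAf : ContMDiff 𝓘(ℝ, AffSpace (n + 1)) 𝓘(ℝ, ℝ × AffSpace n) ∞ fun x => A (f x) :=
    hAs.comp hf.contMDiff
  let Φ : Diffeomorph 𝓘(ℝ, AffSpace (n + 1)) (𝓘(ℝ, ℝ).prod 𝓘(ℝ, AffSpace n)) X (ℝ × N) ∞ :=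
    { Φ₀.toEquiv with
      contMDiff_toFun := by
        refine ContMDiff.prodMk (contDiff_fst.contMDiff.comp hAf) ?_
        refine hNd.contMDiff_of_comp (continuous_snd.comp Φ₀.continuous) ?_
        exact (contDiff_snd.contMDiff.comp hAf).congr fun x => (hdevN x).symm
      contMDiff_invFun := by
        refine hf.contMDiff_of_comp Φ₀.symm.continuous ?_
        have h1 : ContMDiff (𝓘(ℝ, ℝ).prod 𝓘(ℝ, AffSpace n)) 𝓘(ℝ, ℝ × AffSpace n) ∞
            fun z : ℝ × N => (z.1, devN z.2) :=
          contMDiff_fst.prodMk_space (hNd.contMDiff.comp contMDiff_snd)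
        refine (hAs'.comp h1).congr fun z => A.injective ?_
        refine (hA_eq (Φ₀.symm z)).trans ?_
        rw [Φ₀.apply_symm_apply]
        exact (A.apply_symm_apply _).symm }
  refine ⟨N, inferInstance, inferInstance, hNm, Φ, devN, fun t x => ?_, hNd, hdevN,
    fun U hU => ?_⟩
  · change Φ₀ (Θ t x) = (t + (Φ₀ x).1, (Φ₀ x).2)
    ext
    · simp [Φ₀, hAΘ]
    · simp [Φ₀, hAΘ, ← Θ.map_add]
  · obtain ⟨φ, rfl, hφ⟩ := hU
    refine hf.isDiffeoOntoImageOn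
      ((isOpen_univ.prod φ.open_source).preimage Φ.toHomeomorph.continuous) ?_
    intro x hx y hy hxy
    have h1 : ((Φ₀ x).1, devN (Φ₀ x).2) = ((Φ₀ y).1, devN (Φ₀ y).2) := by
      rw [← hA_eq, ← hA_eq, hxy]
    rw [Prod.mk.injEq] at h1
    exact Φ₀.injective (Prod.ext h1.1 ((hφ.injOn_iff.2 φ.injOn) hx.2 hy.2 h1.2))

/-! ### The main theorem -/

theorem theorem2 (n : ℕ)
    {M : Type u} [TopologicalSpace M] [T2Space M] [CompactSpace M] [ConnectedSpace M]
    [ChartedSpace (AffSpace (n + 1)) M] [AffineManifold (n + 1) M]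
    {X : Type w} [TopologicalSpace X]
    [ChartedSpace (AffSpace (n + 1)) X] [AffineManifold (n + 1) X]
    (p : X → M) (hp : IsUniversalAffineCover (n + 1) p)
    (dev : X → AffSpace (n + 1)) (hol : deckGroup p →* AffGroup (n + 1))
    (hdev : IsDevelopingPair (n + 1) p dev hol)
    (v : AffSpace (n + 1)) (hv : v ≠ 0) (hhol : PreservesParallelField hol.range v) :
    ∃ Θ : Flow ℝ X,
      IsCompleteParallelFlow (n + 1) Θ ∧
      (∀ (t : ℝ) (x : X), dev (Θ t x) = dev x + t • v) ∧
      -- every point has a flow-invariant open neighbourhood on which `dev` is a diffeomorphism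
      (∀ x : X, ∃ W : Set X, x ∈ W ∧ IsOpen W ∧ (∀ t : ℝ, Θ t '' W = W) ∧
        IsDiffeoOntoImageOn 𝓘(ℝ, AffSpace (n + 1)) 𝓘(ℝ, AffSpace (n + 1)) dev W) ∧
      -- such sets are the saturations `ℝ × U` of the domains `U` of transverse charts
      ∀ A : AffSpace (n + 1) ≃ᵃ[ℝ] ℝ × AffSpace n, A.linear v = (1, 0) →
        ∃ (N : Type w) (_ : TopologicalSpace N) (_ : ChartedSpace (AffSpace n) N)
          (_ : IsManifold 𝓘(ℝ, AffSpace n) ∞ N)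
          (Φ : Diffeomorph 𝓘(ℝ, AffSpace (n + 1)) (𝓘(ℝ, ℝ).prod 𝓘(ℝ, AffSpace n)) X (ℝ × N) ∞)
          (devN : N → AffSpace n),
          (∀ (t : ℝ) (x : X), Φ (Θ t x) = (t + (Φ x).1, (Φ x).2)) ∧
          IsLocalDiffeomorph 𝓘(ℝ, AffSpace n) 𝓘(ℝ, AffSpace n) ∞ devN ∧
          (∀ x : X, (A (dev x)).2 = devN (Φ x).2) ∧
          ∀ U : Set N, IsDiffeoOntoImageOn 𝓘(ℝ, AffSpace n) 𝓘(ℝ, AffSpace n) devN U →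
            IsDiffeoOntoImageOn 𝓘(ℝ, AffSpace (n + 1)) 𝓘(ℝ, AffSpace (n + 1)) dev
              (Φ ⁻¹' (univ ×ˢ U)) := by
  have hcov := hp.isCoveringMap
  have := hp.simplyConnected
  have : T2Space X := hcov.t2Space
  have : LocallyPathConnectedSpace X :=
    ChartedSpace.locallyPathConnectedSpace (AffSpace (n + 1)) X
  have hloc := hdev.isAffineLocalIso.isLocalDiffeomorph
  obtain ⟨Θ, hΘ⟩ := hloc.isLocalHomeomorph.exists_flow fun t x =>
    liftsSegment_of_isDevelopingPair hcov hloc.isLocalHomeomorph hdev hhol t x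
  refine ⟨Θ, hdev.isAffineLocalIso.isCompleteParallelFlow hv hΘ, hΘ, fun x => ?_,
    fun A hA => exists_flow_trivialization hloc hΘ A hA⟩
  -- The invariant neighbourhoods do not refer to coordinates, so any adapted choice of `A` serves.
  obtain ⟨A, hA⟩ := exists_affineEquiv_linear_apply_eq hv
  obtain ⟨N, _, _, _, Φ, devN, hΦ, hN, -, hU⟩ := exists_flow_trivialization hloc hΘ A hA
  obtain ⟨φ, hx, hφ⟩ := hN (Φ x).2
  have hinv : ∀ t y, y ∈ Φ ⁻¹' (univ ×ˢ φ.source) → Θ t y ∈ Φ ⁻¹' (univ ×ˢ φ.source) := by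
    intro t y hy
    rw [mem_preimage, hΦ]
    exact ⟨trivial, hy.2⟩
  refine ⟨Φ ⁻¹' (univ ×ˢ φ.source), ⟨trivial, hx⟩,
    (isOpen_univ.prod φ.open_source).preimage Φ.toHomeomorph.continuous, fun t => ?_,
    hU _ ⟨φ, rfl, hφ⟩⟩
  refine Subset.antisymm (image_subset_iff.2 (hinv t)) fun y hy => ⟨Θ (-t) y, hinv _ y hy, ?_⟩
  rw [← Θ.map_add, add_neg_cancel, Θ.map_zero_apply]
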